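/- Let $S$ be a real vector space of finite dimension $D$ endowed with two arbitrary norms $\|\cdot\|_2$ and $\|\cdot\|_\infty$. Let $T\subset S$ be countable, let $t_0\in T$, and let $(X_t)_{t\in T}$ be a family of centered real-valued random variables on a probability space. Let $v>0$, $c\ge 0$ and $b$ be real numbers such that, with the convention $1/0=+\infty$, (i) for all $s,t\in T$ with $s\neq t$ and all $\lambda\in\left[0,\frac{1}{c\|s-t\|_\infty}\right)$, $$\mathbb{E}\left[e^{\lambda(X_t-X_s)}\right]\le \exp\left[\frac{\lambda^2\|t-s\|_2^2}{2\left(1-\lambda c\|s-t\|_\infty\right)}\right];$$ (ii) $\|t-t_0\|_2\le v$ and $c\|t-t_0\|_\infty\le b$ for all $t\in T$. Set $Z=\sup_{t\in T}(X_t-X_{t_0})$, $\overline Z=\sup_{t\in T}|X_t-X_{t_0}|$ (with values in $[0,+\infty]$) and $\kappa=18$. Then for all $x\ge 0$, $$\mathbb{P}\left[Z\ge \kappa\left(\sqrt{v^2(D+x)}+b(D+x)\right)\right]\le e^{-x} \quad\text{and}\quad \mathbb{P}\left[\overline Z\ge \kappa\left(\sqrt{v^2(D+x)}+b(D+x)\right)\right]\le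 2e^{-x}.$$ -/

import Mathlib

open MeasureTheory

noncomputable section

namespace BernsteinChaining

/-- A (genuine) norm on a real vector space: a seminorm that vanishes only at `0`. It is a predicate
rather than a type class because two norms are considered on the same space. -/
def IsNorm {S : Type*} [AddCommGroup S] [Module ℝ S] (N : Seminorm ℝ S) : Prop :=
  ∀ x : S, N x = 0 → x = 0

/-- Every `X t` is a random variable (measurable and integrable) with zero mean. -/
def IsCentered {T Ω : Type*} [MeasurableSpace Ω] (μ : Measure Ω) (X : T → Ω → ℝ) : Prop :=
  ∀ t, Measurable (X t) ∧ Integrable (X t) μ ∧ ∫ ω, X t ω ∂μ = 0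

/-- The Bernstein-type bound on the Laplace transforms of the increments of `X`:
for all `s ≠ t` and all `l ∈ [0, 1 / (c δ(s,t)))`,
`E exp (l (X t - X s)) ≤ exp (l² d(s,t)² / (2 (1 - l c δ(s,t))))`,
the expectation being finite. With the convention `1 / 0 = +∞`, and since `c δ(s,t) ≥ 0`, the
condition `l < 1 / (c δ(s,t))` is `l * (c * δ(s,t)) < 1`. -/
def HasBernsteinIncrements {T Ω : Type*} [MeasurableSpace Ω] (μ : Measure Ω) (X : T → Ω → ℝ)
    (d δ : T → T → ℝ) (c : ℝ) : Prop :=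
  ∀ s t : T, s ≠ t → ∀ l : ℝ, 0 ≤ l → l * (c * δ s t) < 1 →
    Integrable (fun ω => Real.exp (l * (X t ω - X s ω))) μ ∧
    ∫ ω, Real.exp (l * (X t ω - X s ω)) ∂μ
      ≤ Real.exp (l ^ 2 * d s t ^ 2 / (2 * (1 - l * (c * δ s t))))

/-- `Z = sup_t (X t - X t₀)`, with values in the extended reals, since it may be `+∞`. -/
def supIncrement {T Ω : Type*} (X : T → Ω → ℝ) (t₀ : T) (ω : Ω) : EReal :=
  ⨆ t : T, ((X t ω - X t₀ ω : ℝ) : EReal)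

/-- `Z̄ = sup_t |X t - X t₀|`, with values in the extended reals. -/
def supAbsIncrement {T Ω : Type*} (X : T → Ω → ℝ) (t₀ : T) (ω : Ω) : EReal :=
  ⨆ t : T, ((|X t ω - X t₀ ω| : ℝ) : EReal)

/-- The numerical constant `κ = 18`. -/
def kappa : ℝ := 18

end BernsteinChaining

end

open MeasureTheory Module ProbabilityTheory
open scoped ENNReal

/-! Chaining in the single norm `N = max (norm₂ / v) (c normInf / b)`, for which the index set lies
in a unit ball and an increment at distance at most `r` is sub-gamma with parameters `r v`, `r b`.
By volume comparison, nets of mesh `2⁻ᵏ` have at most `exp ((k + 2) D)` points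
(`exists_dyadic_net`). Bernstein's bound (`measure_bernstein_tail_le`) on each link, at deviation
level `(2k + 4)(D + x)`, pays for the cardinality and leaves `exp (-x) 2^{-(k+1)}` per level. Link
thresholds add up to `12` times the target quantity (`measure_exists_finset_increment_gt_le`).
Finite index sets exhaust `T`, and `12 < 18` turns the non-strict event into a strict one. -/

namespace BernsteinChaining

/-! ### Metric entropy in finite dimension. -/

section Covering

/-- Volume bound for a separated family in the unit ball of a finite-dimensional normed space. -/
theorem card_le_of_separated_of_norm_sub_le {E ι : Type*} [NormedAddCommGroup E] [NormedSpace ℝ E]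
    [FiniteDimensional ℝ E] (G : Finset ι) (f : ι → E) (x₀ : E) {r : ℝ} (hr : 0 < r)
    (hball : ∀ i ∈ G, ‖f i - x₀‖ ≤ 1)
    (hsep : ∀ i ∈ G, ∀ j ∈ G, i ≠ j → r ≤ ‖f i - f j‖) :
    (G.card : ℝ) ≤ (1 + 2 / r) ^ finrank ℝ E := by
  borelize E
  let μ : Measure E := Measure.addHaar
  have hδ : 0 < r / 2 := by positivity
  have hρ : 0 < 1 + r / 2 := by positivity
  -- Disjoint balls of radius `r / 2` inside one of radius `1 + r / 2`: the volume ratio is `(1 + 2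
  -- / r) ^ D`.
  have hdisj : Set.Pairwise (G : Set ι) (Function.onFun Disjoint fun i => Metric.ball (f i) (r / 2)) := by
    intro i hi j hj hij
    apply Metric.ball_disjoint_ball
    rw [dist_eq_norm, add_halves]
    exact hsep i hi j hj hij
  have hsub : (⋃ i ∈ G, Metric.ball (f i) (r / 2)) ⊆ Metric.ball x₀ (1 + r / 2) := by
    refine Set.iUnion₂_subset fun i hi => Metric.ball_subset_ball' ?_
    rw [dist_eq_norm]
    linarith [hball i hi]
  have hvol : (G.card : ℝ≥0∞) * ENNReal.ofReal ((r / 2) ^ finrank ℝ E) * μ (Metric.ball 0 1) ≤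
      ENNReal.ofReal ((1 + r / 2) ^ finrank ℝ E) * μ (Metric.ball 0 1) := by
    calc
      _ = μ (⋃ i ∈ G, Metric.ball (f i) (r / 2)) := by
        rw [measure_biUnion_finset hdisj fun _ _ => measurableSet_ball]
        simp only [μ.addHaar_ball_of_pos _ hδ, Finset.sum_const, nsmul_eq_mul, mul_assoc]
      _ ≤ μ (Metric.ball x₀ (1 + r / 2)) := measure_mono hsub
      _ = _ := μ.addHaar_ball_of_pos _ hρ
  have hcard : (G.card : ℝ≥0∞) * ENNReal.ofReal ((r / 2) ^ finrank ℝ E) ≤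
      ENNReal.ofReal ((1 + r / 2) ^ finrank ℝ E) :=
    (ENNReal.mul_le_mul_iff_left (Metric.measure_ball_pos _ _ zero_lt_one).ne' measure_ball_lt_top.ne).1 hvol
  have hreal := ENNReal.toReal_le_of_le_ofReal (by positivity) hcard
  rw [ENNReal.toReal_mul, ENNReal.toReal_natCast, ENNReal.toReal_ofReal (by positivity)] at hreal
  have hdiv : 1 + 2 / r = (1 + r / 2) / (r / 2) := by field_simp; ring
  rw [hdiv, div_pow, le_div_iff₀ (by positivity)]
  exact hreal

/-- Volume bound for a separated family in the unit ball of a norm given as a seminorm. -/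
theorem card_le_of_separated {S ι : Type*} [AddCommGroup S] [Module ℝ S] [FiniteDimensional ℝ S]
    (N : Seminorm ℝ S) (hN : IsNorm N) (G : Finset ι) (f : ι → S) (x₀ : S) {r : ℝ} (hr : 0 < r)
    (hball : ∀ i ∈ G, N (f i - x₀) ≤ 1)
    (hsep : ∀ i ∈ G, ∀ j ∈ G, i ≠ j → r ≤ N (f i - f j)) :
    (G.card : ℝ) ≤ (1 + 2 / r) ^ finrank ℝ S := by
  let _ : Norm S := ⟨N⟩
  have core : NormedSpace.Core ℝ S :=
    { norm_nonneg := apply_nonneg N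
      norm_smul := map_smul_eq_mul N
      norm_triangle := map_add_le_add N
      norm_eq_zero_iff := fun x => ⟨hN x, fun h => h ▸ map_zero N⟩ }
  let _ : NormedAddCommGroup S := NormedAddCommGroup.ofCore core
  let _ : NormedSpace ℝ S := NormedSpace.ofCore core
  exact card_le_of_separated_of_norm_sub_le G f x₀ hr hball hsep

/-- A finite set has a maximal separated subset with respect to a proximity relation. -/
theorem exists_separated_net {ι : Type*} (r : ι → ι → Prop) (hrefl : ∀ i, r i i)
    (hsymm : ∀ i j, r i j → r j i) (F : Finset ι) :
    ∃ G ⊆ F, (∀ i ∈ G, ∀ j ∈ G, i ≠ j → ¬ r i j) ∧ ∀ i ∈ F, ∃ j ∈ G, r i j := by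
  classical
  induction F using Finset.induction_on with
  | empty => exact ⟨∅, by simp⟩
  | insert a F _ ih =>
    obtain ⟨G, hGF, hsep, hcov⟩ := ih
    by_cases ha : ∃ j ∈ G, r a j
    · refine ⟨G, hGF.trans (Finset.subset_insert _ _), hsep, ?_⟩
      simpa [Finset.forall_mem_insert] using ⟨ha, hcov⟩
    · push Not at ha
      refine ⟨insert a G, Finset.insert_subset_insert _ hGF, ?_, ?_⟩
      · intro i hi j hj hij
        rcases Finset.mem_insert.1 hi with rfl | hiG <;> rcases Finset.mem_insert.1 hj with rfl | hjG
        · exact absurd rfl hij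
        · exact ha j hjG
        · exact fun h => ha i hiG (hsymm _ _ h)
        · exact hsep i hiG j hjG hij
      · intro i hi
        rcases Finset.mem_insert.1 hi with rfl | hi
        · exact ⟨i, Finset.mem_insert_self _ _, hrefl i⟩
        · obtain ⟨j, hj, hij⟩ := hcov i hi
          exact ⟨j, Finset.mem_insert_of_mem hj, hij⟩

/-- Dyadic nets of controlled cardinality, starting from a single centre. -/
theorem exists_dyadic_net {S ι : Type*} [AddCommGroup S] [Module ℝ S] [FiniteDimensional ℝ S]
    (N : Seminorm ℝ S) (hN : IsNorm N) (F : Finset ι) (f : ι → S) {i₀ : ι} (hi₀ : i₀ ∈ F)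
    (hball : ∀ i ∈ F, N (f i - f i₀) ≤ 1) (k : ℕ) :
    ∃ G ⊆ F, (k = 0 → G = {i₀}) ∧ (G.card : ℝ) ≤ Real.exp ((k + 2) * finrank ℝ S) ∧
      ∀ i ∈ F, ∃ j ∈ G, N (f i - f j) ≤ (1 / 2) ^ k := by
  rcases Nat.eq_zero_or_pos k with rfl | hk
  · refine ⟨{i₀}, by simpa using hi₀, fun _ => rfl, ?_, fun i hi => ⟨i₀, by simp, by simpa using hball i hi⟩⟩
    simp only [Finset.card_singleton, Nat.cast_one]
    exact Real.one_le_exp (by positivity)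
  · obtain ⟨G, hGF, hsep, hcov⟩ := exists_separated_net (fun i j => N (f i - f j) < (1 / 2) ^ k)
      (fun i => by simp) (fun i j h => by rwa [map_sub_rev]) F
    refine ⟨G, hGF, fun h => absurd h hk.ne', ?_, fun i hi => ?_⟩
    · refine (card_le_of_separated N hN G f (f i₀) (r := (1 / 2) ^ k) (by positivity)
        (fun i hi => hball i (hGF hi)) fun i hi j hj hij => not_lt.1 (hsep i hi j hj hij)).trans ?_
      have hbase : 1 + 2 / (1 / 2 : ℝ) ^ k ≤ Real.exp (k + 2) := by
        calc 1 + 2 / (1 / 2 : ℝ) ^ k = 1 + 2 * 2 ^ k := by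
              rw [one_div, inv_pow, div_inv_eq_mul]
          _ ≤ 2 ^ (k + 2) := by
              have : (1 : ℝ) ≤ 2 ^ k := one_le_pow₀ (by norm_num)
              rw [pow_add]; linarith
          _ ≤ Real.exp 1 ^ (k + 2) := by
              gcongr
              linarith [Real.add_one_le_exp 1]
          _ = Real.exp (k + 2) := by rw [← Real.exp_nat_mul]; simp
      calc _ ≤ Real.exp (k + 2) ^ finrank ℝ S := by gcongr
        _ = _ := by rw [← Real.exp_nat_mul, mul_comm]
    · obtain ⟨j, hj, hij⟩ := hcov i hi
      exact ⟨j, hj, hij.le⟩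

end Covering

/-! ### Chernoff bound for sub-gamma variables. -/

section Tail

/-- Bernstein's tail bound for a variable with sub-gamma Laplace transform. -/
theorem measure_bernstein_tail_le {Ω : Type*} [MeasurableSpace Ω] (μ : Measure Ω)
    [IsProbabilityMeasure μ] (Y : Ω → ℝ) {σ a y : ℝ} (hσ : 0 < σ) (ha : 0 ≤ a) (hy : 0 ≤ y)
    (hY : ∀ l : ℝ, 0 ≤ l → l * a < 1 → Integrable (fun ω => Real.exp (l * Y ω)) μ ∧
      ∫ ω, Real.exp (l * Y ω) ∂μ ≤ Real.exp (l ^ 2 * σ ^ 2 / (2 * (1 - l * a)))) :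
    μ {ω | σ * √(2 * y) + a * y ≤ Y ω} ≤ ENNReal.ofReal (Real.exp (-y)) := by
  set q := √(2 * y) with hq
  have hq0 : 0 ≤ q := Real.sqrt_nonneg _
  have hq2 : q ^ 2 = 2 * y := Real.sq_sqrt (by positivity)
  have hpos : 0 < σ + a * q := by positivity
  -- With this `l` the Chernoff exponent equals `-y` exactly.
  set l := q / (σ + a * q) with hl
  have hl0 : 0 ≤ l := by positivity
  have hla : 1 - l * a = σ / (σ + a * q) := by rw [hl]; field_simp; ring
  have hl1 : l * a < 1 := by
    have : 0 < σ / (σ + a * q) := by positivity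
    linarith
  obtain ⟨hint, hmgf⟩ := hY l hl0 hl1
  have hchern := measure_ge_le_exp_mul_mgf (μ := μ) (X := Y) (σ * q + a * y) hl0 hint
  have hexp : -l * (σ * q + a * y) + l ^ 2 * σ ^ 2 / (2 * (1 - l * a)) = -y := by
    rw [hla, show y = q ^ 2 / 2 by linarith, hl]
    field_simp
    ring
  have hle : μ.real {ω | σ * q + a * y ≤ Y ω} ≤ Real.exp (-y) := by
    refine hchern.trans ?_
    rw [← hexp, Real.exp_add]
    exact mul_le_mul_of_nonneg_left hmgf (Real.exp_nonneg _)
  exact (ENNReal.le_ofReal_iff_toReal_le (measure_ne_top _ _) (Real.exp_nonneg _)).2 hle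

end Tail

/-! ### Chaining on finite sets and passage to countable ones. -/

section Chaining

/-- Telescoping along the parents of a point in a tree of nets. -/
theorem sub_root_le_sum_of_links {ι : Type*} (Y : ι → ℝ) (i₀ : ι) (G : ℕ → Finset ι)
    (hG0 : G 0 = {i₀}) (p : ℕ → ι → ι) (hp : ∀ k, ∀ i ∈ G (k + 1), p k i ∈ G k) (B : ℕ → ℝ)
    (hB : ∀ k, ∀ i ∈ G (k + 1), Y i - Y (p k i) ≤ B k) (k : ℕ) :
    ∀ i ∈ G k, Y i - Y i₀ ≤ ∑ m ∈ Finset.range k, B m := by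
  induction k with
  | zero => simp [hG0]
  | succ k ih =>
    intro i hi
    rw [Finset.sum_range_succ]
    linarith [ih _ (hp k i hi), hB k i hi]

/-- Union bound over all the links of a tree of nets. -/
theorem measure_exists_link_gt_le {Ω ι : Type*} [MeasurableSpace Ω] (μ : Measure Ω)
    (X : ι → Ω → ℝ) (G : ℕ → Finset ι) (p : ℕ → ι → ι) (B : ℕ → ℝ) {x : ℝ}
    (hlink : ∀ k, ∀ i ∈ G (k + 1), ((G (k + 1)).card : ℝ≥0∞) *
      μ {ω | B k < X i ω - X (p k i) ω} ≤ ENNReal.ofReal (Real.exp (-x)) * (2 : ℝ≥0∞)⁻¹ ^ (k + 1)) :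
    μ {ω | ∃ k, ∃ i ∈ G (k + 1), B k < X i ω - X (p k i) ω} ≤ ENNReal.ofReal (Real.exp (-x)) := by
  have hset : {ω | ∃ k, ∃ i ∈ G (k + 1), B k < X i ω - X (p k i) ω} =
      ⋃ k, ⋃ i ∈ G (k + 1), {ω | B k < X i ω - X (p k i) ω} := by
    ext ω; simp
  have hlevel : ∀ k, μ (⋃ i ∈ G (k + 1), {ω | B k < X i ω - X (p k i) ω}) ≤
      ENNReal.ofReal (Real.exp (-x)) * (2 : ℝ≥0∞)⁻¹ ^ (k + 1) := by
    intro k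
    rcases (G (k + 1)).eq_empty_or_nonempty with h0 | hne
    · simp [h0]
    · have hc : ((G (k + 1)).card : ℝ≥0∞) ≠ 0 := by simpa using hne.ne_empty
      refine (measure_biUnion_finset_le _ _).trans ?_
      calc _ ≤ ∑ i ∈ G (k + 1), ENNReal.ofReal (Real.exp (-x)) * (2 : ℝ≥0∞)⁻¹ ^ (k + 1) /
              ((G (k + 1)).card : ℝ≥0∞) := by
            refine Finset.sum_le_sum fun i hi => ?_
            rw [ENNReal.le_div_iff_mul_le (Or.inl hc) (Or.inl (by simp)), mul_comm]
            exact hlink k i hi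
        _ = _ := by
            rw [Finset.sum_const, nsmul_eq_mul, ENNReal.mul_div_cancel hc (by simp)]
  rw [hset]
  calc _ ≤ ∑' k, ENNReal.ofReal (Real.exp (-x)) * (2 : ℝ≥0∞)⁻¹ ^ (k + 1) :=
        (measure_iUnion_le _).trans (ENNReal.tsum_le_tsum hlevel)
    _ = _ := by
        rw [ENNReal.tsum_mul_left, ENNReal.tsum_geometric_add_one, ENNReal.one_sub_inv_two,
          inv_inv, ENNReal.inv_mul_cancel (by simp) (by simp), mul_one]

/-- The full series sums to `12`, and its remainder is explicit. This is the source of the constant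
`12`. -/
theorem sum_dyadic_mul_linear_le (K : ℕ) :
    ∑ k ∈ Finset.range K, (1 / 2 : ℝ) ^ k * (2 * k + 4) ≤ 12 := by
  have hclosed : ∑ k ∈ Finset.range K, (1 / 2 : ℝ) ^ k * (2 * k + 4)
      = 12 - (1 / 2 : ℝ) ^ K * (4 * K + 12) := by
    induction K with
    | zero => norm_num
    | succ K ih => rw [Finset.sum_range_succ, ih]; push_cast; ring
  rw [hclosed]
  have : 0 ≤ (1 / 2 : ℝ) ^ K * (4 * K + 12) := by positivity
  linarith

/-- In a finite family of distinct points, all distances exceed some dyadic scale. -/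
theorem exists_dyadic_lt_separation {S ι : Type*} [AddCommGroup S] [Module ℝ S]
    (N : Seminorm ℝ S) (hN : IsNorm N) (F : Finset ι) {f : ι → S} (hf : Function.Injective f) :
    ∃ K : ℕ, ∀ i ∈ F, ∀ j ∈ F, N (f i - f j) ≤ (1 / 2) ^ K → i = j := by
  have hev : ∀ᶠ K : ℕ in Filter.atTop, ∀ i ∈ F, ∀ j ∈ F,
      N (f i - f j) ≤ (1 / 2) ^ K → i = j := by
    rw [Filter.eventually_all_finset]
    intro i _
    rw [Filter.eventually_all_finset]
    intro j _
    by_cases hij : i = j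
    · exact Filter.Eventually.of_forall fun _ _ => hij
    · have hpos : 0 < N (f i - f j) :=
        lt_of_le_of_ne (apply_nonneg _ _) fun h => hij (hf (sub_eq_zero.1 (hN _ h.symm)))
      have hlim := tendsto_pow_atTop_nhds_zero_of_lt_one (r := (1 / 2 : ℝ)) (by norm_num) (by norm_num)
      filter_upwards [hlim.eventually_lt_const hpos] with K hK hle
      exact absurd hle (not_le.2 hK)
  exact hev.exists

/-- Chaining bound over a finite index set whose increments are sub-gamma at every scale of a
norm `N`. -/
theorem measure_exists_finset_increment_gt_le {S ι Ω : Type*} [AddCommGroup S] [Module ℝ S]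
    [FiniteDimensional ℝ S] [MeasurableSpace Ω] (μ : Measure Ω) [IsProbabilityMeasure μ]
    (N : Seminorm ℝ S) (hN : IsNorm N) {f : ι → S} (hf : Function.Injective f)
    (X : ι → Ω → ℝ) {v b x : ℝ} (hv : 0 < v) (hb : 0 ≤ b) (hx : 0 ≤ x) (hD : 0 < finrank ℝ S)
    (htail : ∀ i j, ∀ r y : ℝ, i ≠ j → 0 < r → 0 ≤ y → N (f i - f j) ≤ r →
      μ {ω | r * v * √(2 * y) + r * b * y ≤ X i ω - X j ω} ≤ ENNReal.ofReal (Real.exp (-y)))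
    (F : Finset ι) {i₀ : ι} (hi₀ : i₀ ∈ F) (hball : ∀ i ∈ F, N (f i - f i₀) ≤ 1) :
    μ {ω | ∃ i ∈ F, 12 * (√(v ^ 2 * (finrank ℝ S + x)) + b * (finrank ℝ S + x)) < X i ω - X i₀ ω}
      ≤ ENNReal.ofReal (Real.exp (-x)) := by
  have hD1 : (1 : ℝ) ≤ finrank ℝ S := by exact_mod_cast hD
  set D : ℝ := (finrank ℝ S : ℝ)
  set W := D + x with hW
  have hW0 : 0 ≤ W := by positivity
  set R := √(v ^ 2 * W) + b * W with hR
  have hR0 : 0 ≤ R := by positivity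
  choose G hGF hG0 hGcard hGcov using exists_dyadic_net N hN F f hi₀ hball
  have hpar : ∀ k i, ∃ j, i ∈ F → j ∈ G k ∧ N (f i - f j) ≤ (1 / 2) ^ k := by
    intro k i
    by_cases hi : i ∈ F
    · obtain ⟨j, hj⟩ := hGcov k i hi
      exact ⟨j, fun _ => hj⟩
    · exact ⟨i, fun h => absurd h hi⟩
  choose p hp using hpar
  set B : ℕ → ℝ := fun k => (1 / 2) ^ k * (2 * k + 4) * R with hB
  obtain ⟨K, hK⟩ := exists_dyadic_lt_separation N hN F hf
  have hincl : {ω | ∃ i ∈ F, 12 * R < X i ω - X i₀ ω} ⊆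
      {ω | ∃ k, ∃ i ∈ G (k + 1), B k < X i ω - X (p k i) ω} := by
    rintro ω ⟨i, hi, hlt⟩
    by_contra hcon
    simp only [Set.mem_ofPred_eq, not_exists, not_and, not_lt] at hcon
    -- Below the separation scale, a net point close to `i` can only be `i` itself, so the chain
    -- ends at `i`.
    have hiK : i ∈ G K := by
      obtain ⟨j, hj, hij⟩ := hGcov K i hi
      rwa [hK i hi j (hGF K hj) hij]
    have hsum := sub_root_le_sum_of_links (fun i => X i ω) i₀ G (hG0 0 rfl) p
      (fun k i hi => (hp k i (hGF _ hi)).1) B hcon K i hiK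
    have : ∑ m ∈ Finset.range K, B m ≤ 12 * R := by
      rw [hB, ← Finset.sum_mul]
      exact mul_le_mul_of_nonneg_right (sum_dyadic_mul_linear_le K) hR0
    linarith
  refine (measure_mono hincl).trans (measure_exists_link_gt_le μ X G p B fun k i hi => ?_)
  -- A degenerate link has zero increment; the tail hypothesis covers distinct points only.
  by_cases hip : i = p k i
  · have hBk : 0 ≤ B k := by positivity
    have hempty : {ω | B k < X i ω - X (p k i) ω} = ∅ := by
      rw [← hip]
      ext ω
      simpa using hBk
    simp [hempty]
  · set y : ℝ := (2 * k + 4) * W with hy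
    have hthr : (1 / 2) ^ k * v * √(2 * y) + (1 / 2) ^ k * b * y ≤ B k := by
      -- Since `2 ≤ 2k + 4`, the factor leaves the root as `2k + 4`, matching the linear term.
      have hsqrt : v * √(2 * y) ≤ (2 * k + 4) * √(v ^ 2 * W) := by
        rw [← Real.sqrt_sq hv.le, ← Real.sqrt_sq (show (0 : ℝ) ≤ 2 * k + 4 by positivity),
          ← Real.sqrt_mul (by positivity), ← Real.sqrt_mul (by positivity),
          Real.sq_sqrt (by positivity)]
        apply Real.sqrt_le_sqrt
        have : 0 ≤ v ^ 2 * W * ((2 * k + 4) * (2 * k + 2)) := by positivity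
        rw [hy]
        nlinarith
      have := mul_le_mul_of_nonneg_left hsqrt (show (0 : ℝ) ≤ (1 / 2) ^ k by positivity)
      rw [hB, hR, hy] at *
      simp only at *
      nlinarith
    have hmeas : μ {ω | B k < X i ω - X (p k i) ω} ≤ ENNReal.ofReal (Real.exp (-y)) :=
      (measure_mono fun ω hω => hthr.trans (le_of_lt hω)).trans
        (htail i (p k i) ((1 / 2) ^ k) y hip (by positivity) (by positivity) (hp k i (hGF _ hi)).2)
    have hnum : ((G (k + 1)).card : ℝ) * Real.exp (-y) ≤ Real.exp (-x) * (1 / 2) ^ (k + 1) := by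
      have hhalf : Real.exp (-(k + 1)) ≤ (1 / 2) ^ (k + 1) := by
        have h1 : Real.exp (-1) ≤ 1 / 2 := by
          rw [Real.exp_neg, one_div]
          exact inv_anti₀ (by norm_num) (by linarith [Real.add_one_le_exp 1])
        calc Real.exp (-(k + 1)) = Real.exp (-1) ^ (k + 1) := by
              rw [← Real.exp_nat_mul]; push_cast; ring_nf
          _ ≤ _ := by gcongr
      calc _ ≤ Real.exp (((k + 1 : ℕ) + 2) * D) * Real.exp (-y) := by
            gcongr
            exact hGcard (k + 1)
        _ = Real.exp (((k + 1 : ℕ) + 2) * D - y) := by rw [← Real.exp_add]; ring_nf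
        _ ≤ Real.exp (-x + -(k + 1)) := by
            apply Real.exp_le_exp.2
            have h1 : 0 ≤ (k + 1 : ℝ) * (D - 1) := mul_nonneg (by positivity) (by linarith)
            have h2 : 0 ≤ (2 * k + 3 : ℝ) * x := by positivity
            rw [hy, hW]
            push_cast
            nlinarith
        _ = Real.exp (-x) * Real.exp (-(k + 1)) := Real.exp_add _ _
        _ ≤ _ := by gcongr
    calc _ ≤ ((G (k + 1)).card : ℝ≥0∞) * ENNReal.ofReal (Real.exp (-y)) := by gcongr
      _ = ENNReal.ofReal ((G (k + 1)).card * Real.exp (-y)) := by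
          rw [ENNReal.ofReal_mul (by positivity), ENNReal.ofReal_natCast]
      _ ≤ ENNReal.ofReal (Real.exp (-x) * (1 / 2) ^ (k + 1)) := ENNReal.ofReal_le_ofReal hnum
      _ = _ := by
          rw [ENNReal.ofReal_mul (Real.exp_nonneg _), ENNReal.ofReal_pow (by norm_num), one_div,
            ENNReal.ofReal_inv_of_pos (by norm_num), ENNReal.ofReal_ofNat]

/-- A tail bound that holds uniformly over the finite subsets of a countable index set holds over
the whole index set. -/
theorem measure_exists_le_of_finset {ι Ω : Type*} [Countable ι] [MeasurableSpace Ω] (μ : Measure Ω)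
    (A : ι → Set Ω) (i₀ : ι) {C : ℝ≥0∞} (h : ∀ F : Finset ι, i₀ ∈ F → μ {ω | ∃ i ∈ F, ω ∈ A i} ≤ C) :
    μ {ω | ∃ i, ω ∈ A i} ≤ C := by
  classical
  have hset : {ω | ∃ i, ω ∈ A i} = ⋃ F : Finset ι, {ω | ∃ i ∈ insert i₀ F, ω ∈ A i} := by
    ext ω
    simp only [Set.mem_ofPred_eq, Set.mem_iUnion]
    exact ⟨fun ⟨i, hi⟩ => ⟨{i}, i, by simp, hi⟩, fun ⟨_, i, _, hi⟩ => ⟨i, hi⟩⟩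
  have hmono : Monotone fun F : Finset ι => {ω | ∃ i ∈ insert i₀ F, ω ∈ A i} :=
    fun F F' hFF' ω ⟨i, hi, hω⟩ => ⟨i, Finset.insert_subset_insert _ hFF' hi, hω⟩
  rw [hset, hmono.measure_iUnion]
  exact iSup_le fun F => h _ (Finset.mem_insert_self _ _)

end Chaining

/-! ### Reduction of two norms to one. -/

section TwoNorms

/-- The tail bound for the supremum of the increments at a strictly smaller threshold. -/
theorem measure_exists_increment_gt_le
    {S : Type*} [AddCommGroup S] [Module ℝ S] [FiniteDimensional ℝ S]
    (norm₂ normInf : Seminorm ℝ S) (hnorm₂ : IsNorm norm₂)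
    {Ω : Type*} [MeasurableSpace Ω] (μ : Measure Ω) [IsProbabilityMeasure μ]
    (T : Set S) (hT : T.Countable) (t₀ : T) (X : T → Ω → ℝ)
    {v b c : ℝ} (hv : 0 < v) (hc : 0 ≤ c)
    (hXinc : HasBernsteinIncrements μ X
      (fun s t => norm₂ ((t : S) - (s : S))) (fun s t => normInf ((s : S) - (t : S))) c)
    (hTv : ∀ t ∈ T, norm₂ (t - (t₀ : S)) ≤ v)
    (hTb : ∀ t ∈ T, c * normInf (t - (t₀ : S)) ≤ b) {x : ℝ} (hx : 0 ≤ x) :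
    μ {ω | ∃ t : T, 12 * (√(v ^ 2 * (finrank ℝ S + x)) + b * (finrank ℝ S + x)) < X t ω - X t₀ ω}
      ≤ ENNReal.ofReal (Real.exp (-x)) := by
  have hb : 0 ≤ b := (mul_nonneg hc (apply_nonneg _ _)).trans (hTb t₀ t₀.2)
  -- Chaining needs `1 ≤ D`; in dimension zero all increments vanish.
  rcases Nat.eq_zero_or_pos (finrank ℝ S) with hD | hD
  · have : Subsingleton S := finrank_zero_iff.1 hD
    have hempty : {ω | ∃ t : T, 12 * (√(v ^ 2 * (finrank ℝ S + x)) + b * (finrank ℝ S + x)) <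
        X t ω - X t₀ ω} = ∅ := by
      ext ω
      simp only [Set.mem_ofPred_eq, Set.mem_empty_iff_false, iff_false, not_exists, not_lt]
      intro t
      rw [Subsingleton.elim t t₀, sub_self]
      positivity
    rw [hempty, measure_empty]
    exact zero_le
  have : Countable T := hT
  -- The norm `max (norm₂ / v) (c normInf / b)`, with the second term dropped if `b = 0`.
  let N : Seminorm ℝ S := Real.toNNReal v⁻¹ • norm₂ ⊔ Real.toNNReal (c / b) • normInf
  have hNapply : ∀ z, N z = max (v⁻¹ * norm₂ z) (c / b * normInf z) := fun z => by
    simp [N, Seminorm.sup_apply, NNReal.smul_def,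
      Real.coe_toNNReal _ (inv_nonneg.2 hv.le), Real.coe_toNNReal _ (div_nonneg hc hb)]
  have hN2 : ∀ z, norm₂ z ≤ N z * v := fun z => by
    have := le_max_left (v⁻¹ * norm₂ z) (c / b * normInf z)
    rw [← hNapply, inv_mul_le_iff₀ hv] at this
    linarith
  have hN : IsNorm N := fun z hz => hnorm₂ z
    (le_antisymm (by simpa [hz] using hN2 z) (apply_nonneg _ _))
  have hNinf : ∀ s t : T, c * normInf ((s : S) - t) ≤ N ((s : S) - t) * b := fun s t => by
    -- If `b = 0`, then `c * normInf` vanishes on differences with `t₀`, hence on all differences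
    -- within `T`.
    rcases hb.eq_or_lt with rfl | hb'
    · have htri : normInf ((s : S) - t) ≤ normInf ((s : S) - t₀) + normInf ((t : S) - t₀) := by
        simpa using map_sub_le_add normInf ((s : S) - t₀) ((t : S) - t₀)
      have := mul_le_mul_of_nonneg_left htri hc
      linarith [hTb s s.2, hTb t t.2]
    · have := le_max_right (v⁻¹ * norm₂ ((s : S) - t)) (c / b * normInf ((s : S) - t))
      rw [← hNapply, div_mul_eq_mul_div, div_le_iff₀ hb'] at this
      exact this
  have hball : ∀ t : T, N ((t : S) - t₀) ≤ 1 := fun t => by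
    rw [hNapply, max_le_iff]
    refine ⟨by rw [inv_mul_le_iff₀ hv, mul_one]; exact hTv t t.2, ?_⟩
    rw [div_mul_eq_mul_div]
    exact div_le_one_of_le₀ (hTb t t.2) hb
  refine measure_exists_le_of_finset μ _ t₀ fun F hF =>
    measure_exists_finset_increment_gt_le μ N hN Subtype.val_injective X hv hb hx hD ?_ F hF
      fun t _ => hball t
  intro t s r y hts hr hy hNr
  refine measure_bernstein_tail_le μ _ (mul_pos hr hv) (mul_nonneg hr.le hb) hy fun l hl hl1 => ?_
  have hδ : c * normInf ((s : S) - t) ≤ r * b := by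
    refine (hNinf s t).trans ?_
    rw [map_sub_rev N]
    gcongr
  have hd : norm₂ ((t : S) - s) ≤ r * v := (hN2 _).trans (by gcongr)
  have hl2 := mul_le_mul_of_nonneg_left hδ hl
  obtain ⟨hint, hle⟩ := hXinc s t hts.symm l hl (hl2.trans_lt hl1)
  refine ⟨hint, hle.trans (Real.exp_le_exp.2 ?_)⟩
  have h0 : 0 < 1 - l * (r * b) := by linarith
  have hd0 : 0 ≤ norm₂ ((t : S) - s) := apply_nonneg _ _
  dsimp only
  gcongr

/-- The increments of the opposite process satisfy the same bounds. -/
theorem HasBernsteinIncrements.neg {T Ω : Type*} [MeasurableSpace Ω] {μ : Measure Ω}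
    {X : T → Ω → ℝ} {d δ : T → T → ℝ} {c : ℝ} (h : HasBernsteinIncrements μ X d δ c)
    (hd : ∀ s t, d s t = d t s) (hδ : ∀ s t, δ s t = δ t s) :
    HasBernsteinIncrements μ (fun t ω => -X t ω) d δ c := by
  intro s t hst l hl hl1
  rw [hd s t]
  rw [hδ s t] at hl1 ⊢
  simpa only [neg_sub_neg] using h t s hst.symm l hl hl1

end TwoNorms

end BernsteinChaining

theorem mainTheorem2
    {S : Type*} [AddCommGroup S] [Module ℝ S] [FiniteDimensional ℝ S]
    (norm₂ normInf : Seminorm ℝ S)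
    (hnorm₂ : BernsteinChaining.IsNorm norm₂) (hnormInf : BernsteinChaining.IsNorm normInf)
    {Ω : Type*} [MeasurableSpace Ω] (μ : Measure Ω) [IsProbabilityMeasure μ]
    (T : Set S) (hT : T.Countable) (t₀ : T)
    (X : T → Ω → ℝ) (hX : BernsteinChaining.IsCentered μ X)
    (v b c : ℝ) (hv : 0 < v) (hc : 0 ≤ c)
    (hXinc : BernsteinChaining.HasBernsteinIncrements μ X
      (fun s t => norm₂ ((t : S) - (s : S))) (fun s t => normInf ((s : S) - (t : S))) c)
    (hTv : ∀ t ∈ T, norm₂ (t - (t₀ : S)) ≤ v)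
    (hTb : ∀ t ∈ T, c * normInf (t - (t₀ : S)) ≤ b) :
    (∀ x : ℝ, 0 ≤ x →
      μ {ω | ((BernsteinChaining.kappa *
            (√(v ^ 2 * ((Module.finrank ℝ S : ℝ) + x)) + b * ((Module.finrank ℝ S : ℝ) + x)) : ℝ)
            : EReal) ≤ BernsteinChaining.supIncrement X t₀ ω}
        ≤ ENNReal.ofReal (Real.exp (-x))) ∧
    (∀ x : ℝ, 0 ≤ x →
      μ {ω | ((BernsteinChaining.kappa *
            (√(v ^ 2 * ((Module.finrank ℝ S : ℝ) + x)) + b * ((Module.finrank ℝ S : ℝ) + x)) : ℝ)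
            : EReal) ≤ BernsteinChaining.supAbsIncrement X t₀ ω}
        ≤ ENNReal.ofReal (2 * Real.exp (-x))) := by
  have hb : 0 ≤ b := (mul_nonneg hc (apply_nonneg _ _)).trans (hTb t₀ t₀.2)
  -- A supremum need not be attained, so a strictly smaller threshold is needed to find a witness
  -- `t`. If `D = x = 0` both thresholds are zero, but at `x = 0` the probability bounds are
  -- trivial.
  have hpos : ∀ x : ℝ, 0 < x →
      12 * (√(v ^ 2 * ((Module.finrank ℝ S : ℝ) + x)) + b * ((Module.finrank ℝ S : ℝ) + x)) <
      BernsteinChaining.kappa *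
        (√(v ^ 2 * ((Module.finrank ℝ S : ℝ) + x)) + b * ((Module.finrank ℝ S : ℝ) + x)) := by
    intro x hx
    rw [BernsteinChaining.kappa]
    have : 0 < √(v ^ 2 * ((Module.finrank ℝ S : ℝ) + x)) := Real.sqrt_pos.2 (by positivity)
    have : 0 ≤ b * ((Module.finrank ℝ S : ℝ) + x) := by positivity
    linarith
  have hX1 := fun {x : ℝ} (hx : 0 ≤ x) => BernsteinChaining.measure_exists_increment_gt_le
    norm₂ normInf hnorm₂ μ T hT t₀ X hv hc hXinc hTv hTb hx
  have hX2 := fun {x : ℝ} (hx : 0 ≤ x) => BernsteinChaining.measure_exists_increment_gt_le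
    norm₂ normInf hnorm₂ μ T hT t₀ _ hv hc
    (hXinc.neg (fun s t => map_sub_rev norm₂ _ _) (fun s t => map_sub_rev normInf _ _)) hTv hTb hx
  refine ⟨fun x hx => ?_, fun x hx => ?_⟩
  · rcases hx.eq_or_lt with rfl | hx'
    · simpa using prob_le_one
    refine (measure_mono fun ω hω => ?_).trans (hX1 hx)
    obtain ⟨t, ht⟩ := lt_iSup_iff.1 ((EReal.coe_lt_coe_iff.2 (hpos x hx')).trans_le hω)
    exact ⟨t, EReal.coe_lt_coe_iff.1 ht⟩
  · rcases hx.eq_or_lt with rfl | hx'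
    · refine prob_le_one.trans ?_
      rw [neg_zero, Real.exp_zero, ← ENNReal.ofReal_one]
      exact ENNReal.ofReal_le_ofReal (by norm_num)
    -- The absolute value splits into the upper tails of `X` and `-X`, each costing `exp (-x)`.
    rw [two_mul, ENNReal.ofReal_add (Real.exp_nonneg _) (Real.exp_nonneg _)]
    refine (measure_mono fun ω hω => ?_).trans
      ((measure_union_le _ _).trans (add_le_add (hX1 hx) (hX2 hx)))
    obtain ⟨t, ht⟩ := lt_iSup_iff.1 ((EReal.coe_lt_coe_iff.2 (hpos x hx')).trans_le hω)
    rcases lt_abs.1 (EReal.coe_lt_coe_iff.1 ht) with h | h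
    · exact Or.inl ⟨t, h⟩
    · exact Or.inr ⟨t, by rwa [neg_sub_neg, ← neg_sub]⟩
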